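/- For $x\in\mathbb{C}\setminus[1,\infty)$, let $$\Phi(x,s,v)=\frac1{\Gamma(s)}\int_0^\infty\frac{t^{s-1}e^{-(v-1)t}}{e^t-x}\,dt\qquad(\operatorname{Re}s>0,\ \operatorname{Re}v>0)$$ be the Hurwitz–Lerch zeta function (the analytic continuation of $\sum_{k\ge0}x^k(k+v)^{-s}$, $|x|<1$), and let ${}_2F_1(a,b;c;x)$ be the principal branch of the Gauss hypergeometric function, given for $\operatorname{Re}c>\operatorname{Re}a>0$ by Euler's integral $\frac{\Gamma(c)}{\Gamma(a)\Gamma(c-a)}\int_0^1t^{a-1}(1-t)^{c-a-1}(1-xt)^{-b}dt$. All powers with non-integer exponents are principal values. Let $z\ge1$ be an integer. **(1)** Let $n\ge0$ be an integer and $m,r\in\mathbb{C}$. Assume that either $\operatorname{Im}m>0$ and $\operatorname{Im}r>0$, or that the following two conditions hold: (i) for $0\le p\le n$ the numbers $-e^{2im(2z+1)^p}$ and $-e^{2ir(2z+1)^p}$ are not in $[1,\infty)$; (ii) for $1\le p\le n$, $$-\pi<\arg\frac{i}{\tan\left(\frac14(\pi+2r(2z+1)^p)\right)}-\arg\frac{i}{\tan\left(\frac14(\pi+2m(2z+1)^p)\right)}\le\pi$$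 with principal arguments. Then $$\prod_{p=0}^{n}\prod_{j=1}^{z}\exp\Big(i(-1)^{j+z}(1+2z)^{-p}\big(E^-_{p,j}(m)+E^+_{p,j}(m)-E^-_{p,j}(r)-E^+_{p,j}(r)\big)\Big)\;\prod_{p=0}^{n}\left(\frac{\tan\left(\frac14(\pi+2m(1+2z)^p)\right)}{\tan\left(\frac14(\pi+2r(1+2z)^p)\right)}\right)^{-(-1+(-1)^z)(1+2z)^{-p}}$$ $$=\left(\frac{\tan\frac{2m+\pi+2\pi z}{4+8z}}{\tan\frac{\pi+2r+2\pi z}{4+8z}}\right)^{-1-2z}\left(\frac{\tan\left(\frac14(\pi+2m(1+2z)^n)\right)}{\tan\left(\frac14(\pi+2r(1+2z)^n)\right)}\right)^{(1+2z)^{-n}},$$ where $E^{\pm}_{p,j}(m)=e^{im(1+2z)^{p-1}(1\pm2j+2z)}\,\Phi\left(-e^{2im(1+2z)^p},1,\tfrac12\pm\tfrac{j}{1+2z}\right)$. **(2)** Let $m,r\in\mathbb{C}$ with $-e^{2im},-e^{2ir}\notin[1,\infty)$. Then $$\prod_{j=1}^{z}\exp\Big(i(-1)^{j+z}\big(E^-_j(m)+E^+_j(m)-E^-_j(r)-E^+_j(r)\big)\Big)=\frac{\tan\left(\frac14(2m+\pi)\right)\left(\dfrac{\tan\frac{2m+\pi+2\pi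 z}{4+8z}}{\tan\frac{\pi+2r+2\pi z}{4+8z}}\right)^{-1-2z}}{\tan\left(\frac14(\pi+2r)\right)\left(\dfrac{\tan\left(\frac14(2m+\pi)\right)}{\tan\left(\frac14(\pi+2r)\right)}\right)^{1-(-1)^z}},$$ where $E^{\pm}_j(m)=e^{im\left(1\pm\frac{2j}{1+2z}\right)}\Phi\left(-e^{2im},1,\tfrac12\pm\tfrac{j}{1+2z}\right)$. **(3)** Let $r\in\mathbb{C}\setminus\{0\}$ with $-e^{2ir},-e^{2i/r}\notin[1,\infty)$. Then $$\exp\Big(i\big(6e^{\frac{i}{3r}}{}_2F_1(\tfrac16,1;\tfrac76;-e^{2i/r})-6e^{\frac{ir}{3}}{}_2F_1(\tfrac16,1;\tfrac76;-e^{2ir})+\tfrac65e^{\frac{5i}{3r}}{}_2F_1(\tfrac56,1;\tfrac{11}6;-e^{2i/r})-\tfrac65e^{\frac{5ir}{3}}{}_2F_1(\tfrac56,1;\tfrac{11}6;-e^{2ir})\big)\Big)$$ $$=\tan\left(\tfrac14(2r+\pi)\right)\tan^3\left(\tfrac1{12}(2r+3\pi)\right)\cot\left(\tfrac14\left(\tfrac2r+\pi\right)\right)\cot^3\left(\tfrac1{12}\left(\tfrac2r+3\pi\right)\right).$$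 -/

import Mathlib

noncomputable section

/-- The complex plane cut along the ray `[1, ∞)`. -/
def cutPlane : Set ℂ := {x : ℂ | x.re < 1 ∨ x.im ≠ 0}

/-- The Hurwitz-Lerch zeta function `Φ(x, s, v)`, that is, the analytic continuation of
`∑ k, x ^ k / (k + v) ^ s` (`‖x‖ < 1`) to the cut plane, given by its integral representation
`Φ(x, s, v) = (1 / Γ(s)) ∫₀^∞ t ^ (s - 1) e ^ (-(v - 1) t) / (e ^ t - x) dt`,
valid for `Re s > 0`, `Re v > 0` and `x` in `cutPlane`. -/
def lerchPhi (x s v : ℂ) : ℂ :=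
  1 / Complex.Gamma s *
    ∫ t in Set.Ioi (0 : ℝ),
      (t : ℂ) ^ (s - 1) * Complex.exp (-(v - 1) * (t : ℂ)) / (Complex.exp (t : ℂ) - x)

/-- The Gauss hypergeometric function `₂F₁(a, b; c; x)` (principal branch on the cut plane),
that is, the analytic continuation of the hypergeometric series, given by Euler's integral
`Γ(c) / (Γ(a) Γ(c - a)) ∫₀¹ t ^ (a - 1) (1 - t) ^ (c - a - 1) (1 - x t) ^ (-b) dt`,
valid for `Re c > Re a > 0` and `x` in `cutPlane`. -/
def gaussHyp (a b c x : ℂ) : ℂ :=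
  Complex.Gamma c / (Complex.Gamma a * Complex.Gamma (c - a)) *
    ∫ t in Set.Ioo (0 : ℝ) 1,
      (t : ℂ) ^ (a - 1) * (1 - (t : ℂ)) ^ (c - a - 1) * (1 - x * (t : ℂ)) ^ (-b)

/-- `tan ((π + 2 w) / 4)`. -/
def tanQ (w : ℂ) : ℂ := Complex.tan (1 / 4 * ((Real.pi : ℂ) + 2 * w))

end

/-! Put q = I e^{Iw}. Then I / tan((π + 2w)/4) = (1 + q)/(1 - q), and its principal logarithm L
(`logCotQ`) is an antiderivative of -sec w that tends to 0 as Im w → ∞ along vertical rays in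
`secDomain`. For s = 1 the integral representation turns e^{Imk} Φ(-e^{2Im}, 1, k/2) into the
integral over t > 0 of e^{Iwk}/(1 + e^{2Iw}) on the vertical ray w = m + It/2.

Let N = 2z + 1. The alternating sum over j of these kernels is a geometric sum in -e^{2Iw/N} with
its middle term missing, so it equals (sec(w/N) - (-1)^z sec w)/2 (`secKernel_sum`). Integration
along the ray yields the central identity `lerchPhi_sum_eq`: I times the alternating sum of Lerch
terms is N L(m/N) - (-1)^z L(m).

Subtracting the identity at r and exponentiating gives the single product. For the double product
the identity is used at mN^p with weight N^{-p}; the extra tangent powers replace (-1)^z by 1, and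
the sum telescopes because mN^{p+1}/N = mN^p. Only the branches of the powers need care: for p ≥ 1
the argument condition makes the logarithm of a tangent quotient equal to a difference of values of
L, while at p = 0 the exponents are integers. The hypergeometric formula is z = 1, m = 1/r, since
₂F₁(a, 1; a + 1; x) = a Φ(x, 1, a). -/

section

open Complex MeasureTheory Filter Topology Set

/-! ### The cut domain and its stability -/

/-- The domain on which the integral representation at `-exp (2 I w)` is available. -/
def secDomain : Set ℂ := {w : ℂ | -exp (2 * I * w) ∈ cutPlane}

theorem notMem_cutPlane_iff {x : ℂ} : x ∉ cutPlane ↔ ∃ a : ℝ, 1 ≤ a ∧ x = a := by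
  simp only [cutPlane, Set.mem_ofPred_eq, not_or, not_lt, not_not]
  constructor
  · rintro ⟨h1, h2⟩
    exact ⟨x.re, h1, Complex.ext (by simp) (by simp [h2])⟩
  · rintro ⟨a, ha, rfl⟩
    simpa using ha

theorem secDomain_of_im_pos {w : ℂ} (h : 0 < w.im) : w ∈ secDomain := by
  left
  have h1 : ‖exp (2 * I * w)‖ < 1 := by
    rw [Complex.norm_exp]
    simpa using h
  have h2 := neg_le_abs (exp (2 * I * w)).re
  have h3 := Complex.abs_re_le_norm (exp (2 * I * w))
  simp only [neg_re]
  linarith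

/-- Moving up by t/2 multiplies -exp(2Iw) by e^{-t}, so a point landing on the cut must have started
further out on the cut. -/
theorem secDomain_add {w : ℂ} (h : w ∈ secDomain) {t : ℝ} (ht : 0 ≤ t) :
    w + I * t / 2 ∈ secDomain := by
  by_contra hc
  obtain ⟨a, ha, h1⟩ := notMem_cutPlane_iff.1 hc
  refine notMem_cutPlane_iff.2 ⟨a * Real.exp t, ?_, ?_⟩ h
  · exact one_le_mul_of_one_le_of_one_le ha (Real.one_le_exp ht)
  · push_cast
    rw [← h1, neg_mul, ← Complex.exp_add]
    congr 2
    linear_combination (-(t : ℂ)) * I_sq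

/-- Since N is odd, the N-th power respects the sign: -exp(2Iw/N) = a ≥ 1 would force -exp(2Iw) =
a^N ≥ 1. -/
theorem secDomain_div_odd {w : ℂ} (h : w ∈ secDomain) (z : ℕ) :
    w / (1 + 2 * (z : ℂ)) ∈ secDomain := by
  by_contra hc
  obtain ⟨a, ha, h1⟩ := notMem_cutPlane_iff.1 hc
  refine notMem_cutPlane_iff.2 ⟨a ^ (2 * z + 1), one_le_pow₀ ha, ?_⟩ h
  have hN : (1 + 2 * (z : ℂ)) ≠ 0 := by exact_mod_cast (by omega : 1 + 2 * z ≠ 0)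
  push_cast
  rw [← h1, Odd.neg_pow ⟨z, rfl⟩, ← Complex.exp_nat_mul]
  congr 2
  push_cast
  field_simp
  ring

theorem one_add_exp_ne_zero {w : ℂ} (h : w ∈ secDomain) : 1 + exp (2 * I * w) ≠ 0 := by
  intro hc
  refine notMem_cutPlane_iff.2 ⟨1, le_rfl, ?_⟩ h
  push_cast
  linear_combination -hc

/-! ### The tangent as a Möbius function of q = I exp(Iw) -/

theorem sq_I_mul_exp (w : ℂ) : (I * exp (I * w)) ^ 2 = -exp (2 * I * w) := by
  rw [mul_pow, I_sq, ← Complex.exp_nat_mul]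
  push_cast
  ring_nf

theorem one_sub_ne_zero_of_secDomain {w : ℂ} (h : w ∈ secDomain) : 1 - I * exp (I * w) ≠ 0 := by
  intro hc
  apply one_add_exp_ne_zero h
  linear_combination sq_I_mul_exp w + (1 + I * exp (I * w)) * hc

theorem one_add_ne_zero_of_secDomain {w : ℂ} (h : w ∈ secDomain) : 1 + I * exp (I * w) ≠ 0 := by
  intro hc
  apply one_add_exp_ne_zero h
  linear_combination sq_I_mul_exp w + (1 - I * exp (I * w)) * hc

theorem tanQ_eq {w : ℂ} (h : w ∈ secDomain) :
    tanQ w = I * (1 - I * exp (I * w)) / (1 + I * exp (I * w)) := by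
  have hu : exp (1 / 4 * ((Real.pi : ℂ) + 2 * w) * I) ^ 2 = I * exp (I * w) := by
    have hI : exp (Real.pi / 2 * I + I * w) = I * exp (I * w) := by
      rw [Complex.exp_add, Complex.exp_pi_div_two_mul_I]
    rw [← Complex.exp_nat_mul, ← hI]
    congr 1
    push_cast
    ring
  have h1 := one_add_ne_zero_of_secDomain h
  unfold tanQ
  rw [Complex.tan, Complex.sin, Complex.cos, neg_mul, Complex.exp_neg]
  rw [← hu] at h1 ⊢
  have h0 := Complex.exp_ne_zero (1 / 4 * ((Real.pi : ℂ) + 2 * w) * I)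
  generalize exp (1 / 4 * ((Real.pi : ℂ) + 2 * w) * I) = e at *
  have h2 : e + e⁻¹ ≠ 0 := by
    intro hc
    apply h1
    have : (1 + e ^ 2) = e * (e + e⁻¹) := by field_simp; ring
    rw [this, hc, mul_zero]
  field_simp
  rw [add_comm (e ^ 2), mul_div_cancel_right₀ _ h1]

theorem tanQ_ne_zero {w : ℂ} (h : w ∈ secDomain) : tanQ w ≠ 0 := by
  rw [tanQ_eq h]
  exact div_ne_zero (mul_ne_zero I_ne_zero (one_sub_ne_zero_of_secDomain h))
    (one_add_ne_zero_of_secDomain h)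

theorem I_div_tanQ {w : ℂ} (h : w ∈ secDomain) :
    I / tanQ w = (1 + I * exp (I * w)) / (1 - I * exp (I * w)) := by
  have h1 := one_add_ne_zero_of_secDomain h
  have h2 := one_sub_ne_zero_of_secDomain h
  rw [tanQ_eq h]
  field_simp

/-- If (1 + q)/(1 - q) = s ≤ 0, then q = (s - 1)/(s + 1) is real with |q| ≥ 1, so q² = -exp(2Iw)
lies on the cut. Hence the principal logarithm is smooth on the whole domain. -/
theorem I_div_tanQ_mem_slitPlane {w : ℂ} (h : w ∈ secDomain) : I / tanQ w ∈ slitPlane := by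
  rw [I_div_tanQ h]
  have h2 := one_sub_ne_zero_of_secDomain h
  have hsq := sq_I_mul_exp w
  generalize I * exp (I * w) = q at *
  by_contra hc
  rw [Complex.mem_slitPlane_iff, not_or, not_lt, not_not] at hc
  obtain ⟨s, hs⟩ : ∃ s : ℝ, (1 + q) / (1 - q) = s := ⟨_, Complex.ext rfl (by simp [hc.2])⟩
  have hs0 : s ≤ 0 := by simpa [hs] using hc.1
  rw [div_eq_iff h2] at hs
  have hs1 : s + 1 ≠ 0 := by
    intro h3
    have : (s : ℂ) = -1 := by exact_mod_cast (by linarith : s = -1)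
    rw [this] at hs
    have h4 : (2 : ℂ) = 0 := by linear_combination hs
    norm_num at h4
  have hs1' : (s : ℂ) + 1 ≠ 0 := by exact_mod_cast hs1
  have hq : q = ((s - 1) / (s + 1) : ℝ) := by
    push_cast
    rw [eq_div_iff hs1']
    linear_combination hs
  refine notMem_cutPlane_iff.2 ⟨((s - 1) / (s + 1)) ^ 2, ?_, ?_⟩ h
  · rw [div_pow, le_div_iff₀ (by positivity)]
    nlinarith
  · rw [← hsq, hq]
    push_cast
    rfl

/-- For Im w > 0 one has |q| < 1, and q ↦ (1 + q)/(1 - q) maps the unit disc to the right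
half-plane. -/
theorem re_I_div_tanQ_pos {w : ℂ} (h : 0 < w.im) : 0 < (I / tanQ w).re := by
  rw [I_div_tanQ (secDomain_of_im_pos h)]
  have hq : ‖I * exp (I * w)‖ < 1 := by
    rw [norm_mul, Complex.norm_I, one_mul, Complex.norm_exp]
    simpa using h
  have h2 := one_sub_ne_zero_of_secDomain (secDomain_of_im_pos h)
  generalize I * exp (I * w) = q at *
  have h3 : q.re * q.re + q.im * q.im < 1 := by
    rw [← Complex.normSq_apply, Complex.normSq_eq_norm_sq]
    nlinarith [norm_nonneg q]
  have h4 := Complex.normSq_pos.2 h2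
  rw [Complex.div_re, ← add_div]
  apply div_pos _ h4
  simp
  nlinarith

/-! ### An antiderivative of the secant along vertical rays -/

/-- The branch of `log (I / tanQ w)` on `secDomain` that vanishes at `I ∞`. -/
noncomputable def logCotQ (w : ℂ) : ℂ := log (I / tanQ w)

theorem exp_logCotQ {w : ℂ} (h : w ∈ secDomain) : exp (logCotQ w) = I / tanQ w :=
  Complex.exp_log (slitPlane_ne_zero (I_div_tanQ_mem_slitPlane h))

theorem exp_logCotQ_sub {w v : ℂ} (hw : w ∈ secDomain) (hv : v ∈ secDomain) :
    exp (logCotQ v - logCotQ w) = tanQ w / tanQ v := by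
  have h1 := tanQ_ne_zero hw
  have h2 := tanQ_ne_zero hv
  rw [Complex.exp_sub, exp_logCotQ hw, exp_logCotQ hv]
  field_simp

theorem log_tanQ_div {w v : ℂ} (hw : w ∈ secDomain) (hv : v ∈ secDomain)
    (h : arg (I / tanQ v) - arg (I / tanQ w) ∈ Set.Ioc (-Real.pi) Real.pi) :
    log (tanQ w / tanQ v) = logCotQ v - logCotQ w := by
  rw [← exp_logCotQ_sub hw hv]
  apply Complex.log_exp
  · simpa [logCotQ, Complex.log_im] using h.1
  · simpa [logCotQ, Complex.log_im] using h.2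

/-- The chain rule for L' = -sec. The speed c serves two rays: c = 1 from m, and c = 1/N from m/N.
As `h` covers only s ≥ 0, the endpoint is treated by one-sided continuity. -/
theorem logCotQ_comp_hasDerivAt {m c : ℂ} {t : ℝ}
    (h : ∀ s : ℝ, 0 ≤ s → m + I * c * s / 2 ∈ secDomain) (ht : 0 < t) :
    HasDerivAt (fun s : ℝ => logCotQ (m + I * c * s / 2))
      (-(I * c) * (exp (I * (m + I * c * t / 2)) / (1 + exp (2 * I * (m + I * c * t / 2))))) t := by
  have hw := h t ht.le
  have hlin : HasDerivAt (fun s : ℝ => m + I * c * s / 2) (I * c / 2) t := by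
    have := (((hasDerivAt_id t).ofReal_comp.const_mul (I * c)).div_const 2).const_add m
    simpa using this
  have hq : HasDerivAt (fun s : ℝ => I * exp (I * (m + I * c * s / 2)))
      (I * (exp (I * (m + I * c * t / 2)) * (I * (I * c / 2)))) t :=
    ((hlin.const_mul I).cexp).const_mul I
  have h1 := one_add_ne_zero_of_secDomain hw
  have h2 := one_sub_ne_zero_of_secDomain hw
  have h3 := one_add_exp_ne_zero hw
  have hs : (1 + I * exp (I * (m + I * c * t / 2))) / (1 - I * exp (I * (m + I * c * t / 2)))
      ∈ slitPlane := I_div_tanQ hw ▸ I_div_tanQ_mem_slitPlane hw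
  have key := ((hq.const_add 1).div (hq.const_sub 1) h2).clog_real hs
  have heq : (fun s : ℝ => logCotQ (m + I * c * s / 2)) =ᶠ[𝓝 t] fun s : ℝ =>
      log ((1 + I * exp (I * (m + I * c * s / 2))) / (1 - I * exp (I * (m + I * c * s / 2)))) := by
    filter_upwards [lt_mem_nhds ht] with s hs
    rw [logCotQ, I_div_tanQ (h s (le_of_lt hs))]
  refine (key.congr_of_eventuallyEq heq).congr_deriv ?_
  have hsq := sq_I_mul_exp (m + I * c * t / 2)
  have h4 : exp (2 * I * (m + I * c * t / 2)) = -(I * exp (I * (m + I * c * t / 2))) ^ 2 := by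
    rw [hsq, neg_neg]
  simp only [Pi.div_apply]
  rw [h4] at h3 ⊢
  generalize exp (I * (m + I * c * t / 2)) = e at *
  have h5 : 1 + -(I * e) ^ 2 = (1 + I * e) * (1 - I * e) := by ring
  rw [h5]
  field_simp
  linear_combination (2 * e * c) * I_sq

theorem logCotQ_tendsto {m c : ℂ} (hc : 0 < c.re)
    (h : ∀ s : ℝ, 0 ≤ s → m + I * c * s / 2 ∈ secDomain) :
    Tendsto (fun s : ℝ => logCotQ (m + I * c * s / 2)) atTop (𝓝 0) := by
  have hq : Tendsto (fun s : ℝ => I * exp (I * (m + I * c * s / 2))) atTop (𝓝 0) := by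
    rw [tendsto_zero_iff_norm_tendsto_zero]
    have : ∀ s : ℝ, ‖I * exp (I * (m + I * c * s / 2))‖ = Real.exp (-m.im + -(c.re / 2 * s)) := by
      intro s
      rw [norm_mul, Complex.norm_I, one_mul, Complex.norm_exp]
      congr 1
      simp
      ring
    simp only [this]
    apply Real.tendsto_exp_atBot.comp
    apply tendsto_atBot_add_const_left
    exact tendsto_neg_atTop_atBot.comp (tendsto_id.const_mul_atTop (by positivity))
  have h1 : Tendsto (fun s : ℝ => log ((1 + I * exp (I * (m + I * c * s / 2))) /
      (1 - I * exp (I * (m + I * c * s / 2))))) atTop (𝓝 (log ((1 + 0) / (1 - 0)))) := by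
    refine Tendsto.clog ((hq.const_add 1).div (hq.const_sub 1) (by simp)) (by simp)
  simp only [add_zero, sub_zero, div_one, Complex.log_one] at h1
  refine h1.congr' ?_
  filter_upwards [eventually_ge_atTop 0] with s hs
  rw [logCotQ, I_div_tanQ (h s hs)]

theorem logCotQ_comp_continuousWithinAt {m c : ℂ}
    (h : ∀ s : ℝ, 0 ≤ s → m + I * c * s / 2 ∈ secDomain) :
    ContinuousWithinAt (fun s : ℝ => logCotQ (m + I * c * s / 2)) (Set.Ici 0) 0 := by
  have h0 := h 0 le_rfl
  have h1 : ContinuousAt (fun s : ℝ => log ((1 + I * exp (I * (m + I * c * s / 2))) /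
      (1 - I * exp (I * (m + I * c * s / 2))))) 0 := by
    refine ContinuousAt.clog (ContinuousAt.div (by fun_prop) (by fun_prop)
      (one_sub_ne_zero_of_secDomain h0)) ?_
    exact I_div_tanQ h0 ▸ I_div_tanQ_mem_slitPlane h0
  refine h1.continuousWithinAt.congr (fun s hs => ?_) ?_
  · rw [logCotQ, I_div_tanQ (h s hs)]
  · rw [logCotQ, I_div_tanQ h0]

/-! ### Lerch terms as integrals of secant-type kernels -/

theorem lerchPhi_one_eq {m v k : ℂ} (hk : k = 2 * v) :
    exp (I * m * k) * lerchPhi (-exp (2 * I * m)) 1 v =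
      ∫ t in Ioi (0 : ℝ), exp (I * (m + I * t / 2) * k) / (1 + exp (2 * I * (m + I * t / 2))) := by
  rw [lerchPhi, Complex.Gamma_one, div_one, one_mul, ← integral_const_mul]
  refine setIntegral_congr_fun measurableSet_Ioi fun t _ => ?_
  have e1 : exp (I * (m + I * t / 2) * k) = exp (I * m * k) * exp (-v * t) := by
    rw [← Complex.exp_add, hk]
    congr 1
    linear_combination (v * t) * I_sq
  have e2 : exp (2 * I * (m + I * t / 2)) = exp (2 * I * m) * (exp t)⁻¹ := by
    rw [← Complex.exp_neg, ← Complex.exp_add]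
    congr 1
    linear_combination (t : ℂ) * I_sq
  have e3 : exp (-(v - 1) * t) = exp (-v * t) * exp t := by
    rw [← Complex.exp_add]
    congr 1
    ring
  have h0 := Complex.exp_ne_zero t
  have e4 : 1 + exp (2 * I * m) * (exp t)⁻¹ = (exp t - -exp (2 * I * m)) / exp t := by
    field_simp
    ring
  simp only [sub_self, cpow_zero, one_mul]
  rw [e1, e2, e3, e4, div_div_eq_mul_div]
  ring

/-- The denominator does not vanish on the closed ray and tends to 1, so the integrand is continuous
and decays like exp(-(Re k) t/2). -/
theorem integrableOn_secKernel {m k : ℂ} (hm : m ∈ secDomain) (hk : 0 < k.re) :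
    IntegrableOn (fun t : ℝ => exp (I * (m + I * t / 2) * k) /
      (1 + exp (2 * I * (m + I * t / 2)))) (Ioi 0) := by
  suffices h : IntegrableOn (fun t : ℝ => exp (I * (m + I * t / 2) * k) /
      (1 + exp (2 * I * (m + I * t / 2)))) (Ici 0) from h.mono_set Ioi_subset_Ici_self
  refine LocallyIntegrableOn.integrableOn_of_isBigO_atTop
    (g := fun t : ℝ => Real.exp (-(k.re / 2) * t)) ?_ ?_
    ⟨Ioi 0, Ioi_mem_atTop 0, exp_neg_integrableOn_Ioi 0 (by positivity)⟩
  · refine ContinuousOn.locallyIntegrableOn ?_ measurableSet_Ici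
    refine ContinuousOn.div (by fun_prop) (by fun_prop) fun t ht => ?_
    exact one_add_exp_ne_zero (secDomain_add hm ht)
  · have h1 : (fun t : ℝ => exp (I * (m + I * t / 2) * k)) =O[atTop]
        fun t : ℝ => Real.exp (-(k.re / 2) * t) := by
      refine Asymptotics.IsBigO.of_bound (Real.exp (I * m * k).re)
        (Eventually.of_forall fun t => le_of_eq ?_)
      rw [Complex.norm_exp, Real.norm_eq_abs, Real.abs_exp, ← Real.exp_add]
      congr 1
      simp
      ring
    have h2 : Tendsto (fun t : ℝ => exp (2 * I * (m + I * t / 2))) atTop (𝓝 0) := by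
      rw [tendsto_zero_iff_norm_tendsto_zero]
      have : ∀ t : ℝ, ‖exp (2 * I * (m + I * t / 2))‖ = Real.exp (-2 * m.im + -t) := by
        intro t
        rw [Complex.norm_exp]
        congr 1
        simp
        ring
      simp only [this]
      exact Real.tendsto_exp_atBot.comp
        (tendsto_atBot_add_const_left _ _ tendsto_neg_atTop_atBot)
    have h3 : Tendsto (fun t : ℝ => (1 + exp (2 * I * (m + I * t / 2)))⁻¹) atTop
        (𝓝 (1 + 0)⁻¹) := (h2.const_add 1).inv₀ (by simp)
    simpa [div_eq_mul_inv] using h1.mul (h3.isBigO_one ℝ)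

/-- The terms are (-1)^k y^(2k+1) for 0 ≤ k ≤ 2z, with k = z ∓ j, except the middle one k = z. The
full geometric sum gives the first term on the right; the missing middle gives the second. -/
theorem alternating_odd_power_sum (y : ℂ) (z : ℕ) :
    (1 + y ^ 2) * ∑ j ∈ Finset.Icc 1 z,
        (-1) ^ (j + z) * (y ^ (2 * (z - j) + 1) + y ^ (2 * (z + j) + 1)) =
      y * (1 + y ^ (2 * (2 * z + 1))) - (-1) ^ z * y ^ (2 * z + 1) * (1 + y ^ 2) := by
  induction z with
  | zero => simp
  | succ z ih =>
    rw [Finset.sum_Icc_succ_top (by omega)]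
    -- Passing from z to z + 1 multiplies the old terms by -y² and adds the two new extreme terms,
    -- at j = z + 1.
    have : ∑ j ∈ Finset.Icc 1 z, (-1) ^ (j + (z + 1)) *
          (y ^ (2 * (z + 1 - j) + 1) + y ^ (2 * (z + 1 + j) + 1)) =
        -y ^ 2 * ∑ j ∈ Finset.Icc 1 z,
          (-1) ^ (j + z) * (y ^ (2 * (z - j) + 1) + y ^ (2 * (z + j) + 1)) := by
      rw [Finset.mul_sum]
      refine Finset.sum_congr rfl fun j hj => ?_
      have hj := (Finset.mem_Icc.1 hj).2
      rw [show 2 * (z + 1 - j) + 1 = 2 * (z - j) + 1 + 2 by omega]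
      ring
    rw [this, mul_add, mul_left_comm, ih, (Even.neg_one_pow ⟨z + 1, rfl⟩ :
      (-1 : ℂ) ^ (z + 1 + (z + 1)) = 1)]
    simp only [Nat.sub_self]
    ring

theorem secKernel_sum {w : ℂ} (hw : w ∈ secDomain) (z : ℕ) :
    ∑ j ∈ Finset.Icc 1 z, (-1) ^ (j + z) *
      (exp (I * w * (1 - 2 * j / (1 + 2 * (z : ℂ)))) / (1 + exp (2 * I * w)) +
        exp (I * w * (1 + 2 * j / (1 + 2 * (z : ℂ)))) / (1 + exp (2 * I * w))) =
      exp (I * (w / (1 + 2 * (z : ℂ)))) / (1 + exp (2 * I * (w / (1 + 2 * (z : ℂ))))) -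
        (-1) ^ z * (exp (I * w) / (1 + exp (2 * I * w))) := by
  have hN : (1 + 2 * (z : ℂ)) ≠ 0 := by exact_mod_cast (by omega : 1 + 2 * z ≠ 0)
  have h1 := one_add_exp_ne_zero hw
  have h2 := one_add_exp_ne_zero (secDomain_div_odd hw z)
  -- With y = exp(Iw/N), the fractional exponents 1 ∓ 2j/N of exp(Iw) become the integer powers N ∓
  -- 2j of y.
  have key := alternating_odd_power_sum (exp (I * (w / (1 + 2 * (z : ℂ))))) z
  have p2 : exp (I * (w / (1 + 2 * (z : ℂ)))) ^ 2 = exp (2 * I * (w / (1 + 2 * (z : ℂ)))) := by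
    rw [← Complex.exp_nat_mul]
    push_cast
    ring_nf
  have pN : exp (I * (w / (1 + 2 * (z : ℂ)))) ^ (2 * z + 1) = exp (I * w) := by
    rw [← Complex.exp_nat_mul]
    congr 1
    push_cast
    field_simp
    ring
  have p2N : exp (I * (w / (1 + 2 * (z : ℂ)))) ^ (2 * (2 * z + 1)) = exp (2 * I * w) := by
    rw [mul_comm 2 (2 * z + 1), pow_mul, pN, ← Complex.exp_nat_mul]
    push_cast
    ring_nf
  have hsum : ∑ j ∈ Finset.Icc 1 z, (-1) ^ (j + z) *
      (exp (I * w * (1 - 2 * j / (1 + 2 * (z : ℂ)))) / (1 + exp (2 * I * w)) +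
        exp (I * w * (1 + 2 * j / (1 + 2 * (z : ℂ)))) / (1 + exp (2 * I * w))) =
      (∑ j ∈ Finset.Icc 1 z, (-1) ^ (j + z) *
        (exp (I * (w / (1 + 2 * (z : ℂ)))) ^ (2 * (z - j) + 1) +
          exp (I * (w / (1 + 2 * (z : ℂ)))) ^ (2 * (z + j) + 1))) / (1 + exp (2 * I * w)) := by
    rw [Finset.sum_div]
    refine Finset.sum_congr rfl fun j hj => ?_
    have hj := (Finset.mem_Icc.1 hj).2
    rw [← add_div, mul_div_assoc ((-1) ^ (j + z)), ← Complex.exp_nat_mul, ← Complex.exp_nat_mul]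
    push_cast [Nat.cast_sub hj]
    congr 4 <;> · field_simp; ring
  rw [hsum]
  rw [p2, pN, p2N] at key
  rw [mul_div_assoc' ((-1) ^ z), div_sub_div _ _ h2 h1, div_eq_div_iff h1 (mul_ne_zero h2 h1)]
  linear_combination (1 + exp (2 * I * w)) * key

/-! ### Integration along the ray: the central identity -/

/-- Integrability is asked only of the combination, where it is inherited from the sum of kernels.
-/
theorem integral_Ioi_linear_combination {f g f' g' : ℝ → ℂ} {a b c : ℂ}
    (hf : ContinuousWithinAt f (Ici 0) 0) (hg : ContinuousWithinAt g (Ici 0) 0)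
    (hf' : ∀ t ∈ Ioi (0 : ℝ), HasDerivAt f (f' t) t)
    (hg' : ∀ t ∈ Ioi (0 : ℝ), HasDerivAt g (g' t) t)
    (hf0 : Tendsto f atTop (𝓝 0)) (hg0 : Tendsto g atTop (𝓝 0))
    (hint : IntegrableOn (fun t => c * (a * f' t - b * g' t)) (Ioi 0)) :
    ∫ t in Ioi (0 : ℝ), c * (a * f' t - b * g' t) = -(c * (a * f 0 - b * g 0)) := by
  have hlim : Tendsto (fun t => c * (a * f t - b * g t)) atTop (𝓝 0) := by
    simpa using ((hf0.const_mul a).sub (hg0.const_mul b)).const_mul c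
  rw [integral_Ioi_of_hasDerivAt_of_tendsto (f := fun t => c * (a * f t - b * g t)) ?_ ?_ hint hlim,
    zero_sub]
  · exact continuousWithinAt_const.mul
      ((continuousWithinAt_const.mul hf).sub (continuousWithinAt_const.mul hg))
  · exact fun t ht => (((hf' t ht).const_mul a).sub ((hg' t ht).const_mul b)).const_mul c

theorem lerchPhi_sum_eq {m : ℂ} (hm : m ∈ secDomain) (z : ℕ) :
    I * ∑ j ∈ Finset.Icc 1 z, (-1) ^ (j + z) *
      (exp (I * m * (1 - 2 * j / (1 + 2 * (z : ℂ)))) *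
          lerchPhi (-exp (2 * I * m)) 1 (1 / 2 - j / (1 + 2 * (z : ℂ))) +
        exp (I * m * (1 + 2 * j / (1 + 2 * (z : ℂ)))) *
          lerchPhi (-exp (2 * I * m)) 1 (1 / 2 + j / (1 + 2 * (z : ℂ)))) =
      (1 + 2 * (z : ℂ)) * logCotQ (m / (1 + 2 * (z : ℂ))) - (-1) ^ z * logCotQ m := by
  have hN : (1 + 2 * (z : ℂ)) ≠ 0 := by exact_mod_cast (by omega : 1 + 2 * z ≠ 0)
  have hNr : (0 : ℝ) < 1 + 2 * z := by positivity
  -- From j ≤ z comes 2j < N, which is what makes every kernel decay.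
  have hre : ∀ j ∈ Finset.Icc 1 z, 0 < (1 - 2 * (j : ℂ) / (1 + 2 * (z : ℂ))).re ∧
      0 < (1 + 2 * (j : ℂ) / (1 + 2 * (z : ℂ))).re := by
    intro j hj
    have hj : (j : ℝ) ≤ z := by exact_mod_cast (Finset.mem_Icc.1 hj).2
    rw [show 1 - 2 * (j : ℂ) / (1 + 2 * (z : ℂ)) = ((1 - 2 * j / (1 + 2 * z) : ℝ) : ℂ) by
      push_cast; rfl, show 1 + 2 * (j : ℂ) / (1 + 2 * (z : ℂ)) =
        ((1 + 2 * j / (1 + 2 * z) : ℝ) : ℂ) by push_cast; rfl, ofReal_re, ofReal_re]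
    refine ⟨?_, by positivity⟩
    rw [sub_pos, div_lt_one hNr]
    linarith
  have hint : ∀ j ∈ Finset.Icc 1 z, IntegrableOn (fun t : ℝ => (-1 : ℂ) ^ (j + z) *
      (exp (I * (m + I * t / 2) * (1 - 2 * j / (1 + 2 * (z : ℂ)))) /
          (1 + exp (2 * I * (m + I * t / 2))) +
        exp (I * (m + I * t / 2) * (1 + 2 * j / (1 + 2 * (z : ℂ)))) /
          (1 + exp (2 * I * (m + I * t / 2))))) (Ioi 0) := fun j hj =>
    ((integrableOn_secKernel hm (hre j hj).1).add
      (integrableOn_secKernel hm (hre j hj).2)).const_mul _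
  have hsum : ∑ j ∈ Finset.Icc 1 z, (-1) ^ (j + z) *
      (exp (I * m * (1 - 2 * j / (1 + 2 * (z : ℂ)))) *
          lerchPhi (-exp (2 * I * m)) 1 (1 / 2 - j / (1 + 2 * (z : ℂ))) +
        exp (I * m * (1 + 2 * j / (1 + 2 * (z : ℂ)))) *
          lerchPhi (-exp (2 * I * m)) 1 (1 / 2 + j / (1 + 2 * (z : ℂ)))) =
      ∫ t in Ioi (0 : ℝ), ∑ j ∈ Finset.Icc 1 z, (-1 : ℂ) ^ (j + z) *
      (exp (I * (m + I * t / 2) * (1 - 2 * j / (1 + 2 * (z : ℂ)))) /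
          (1 + exp (2 * I * (m + I * t / 2))) +
        exp (I * (m + I * t / 2) * (1 + 2 * j / (1 + 2 * (z : ℂ)))) /
          (1 + exp (2 * I * (m + I * t / 2)))) := by
    rw [integral_finsetSum _ hint]
    refine Finset.sum_congr rfl fun j hj => ?_
    rw [integral_const_mul, integral_add (integrableOn_secKernel hm (hre j hj).1)
      (integrableOn_secKernel hm (hre j hj).2), lerchPhi_one_eq (by ring), lerchPhi_one_eq (by ring)]
  have hdom : ∀ s : ℝ, 0 ≤ s → m + I * 1 * s / 2 ∈ secDomain := fun s hs => by
    rw [mul_one]; exact secDomain_add hm hs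
  -- The ray from m/N at speed 1/N is the ray from m divided by N, so both antiderivatives share the
  -- parameter t.
  have hlin : ∀ s : ℝ, m / (1 + 2 * (z : ℂ)) + I * (1 / (1 + 2 * (z : ℂ))) * s / 2 =
      (m + I * 1 * s / 2) / (1 + 2 * (z : ℂ)) := fun s => by field_simp
  have hdom' : ∀ s : ℝ, 0 ≤ s →
      m / (1 + 2 * (z : ℂ)) + I * (1 / (1 + 2 * (z : ℂ))) * s / 2 ∈ secDomain := fun s hs => by
    rw [hlin]; exact secDomain_div_odd (hdom s hs) z
  have hcpos : 0 < (1 / (1 + 2 * (z : ℂ))).re := by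
    rw [show 1 / (1 + 2 * (z : ℂ)) = ((1 / (1 + 2 * z) : ℝ) : ℂ) by push_cast; rfl, ofReal_re]
    positivity
  have hder : ∀ t ∈ Ioi (0 : ℝ), ∑ j ∈ Finset.Icc 1 z, (-1 : ℂ) ^ (j + z) *
      (exp (I * (m + I * t / 2) * (1 - 2 * j / (1 + 2 * (z : ℂ)))) /
          (1 + exp (2 * I * (m + I * t / 2))) +
        exp (I * (m + I * t / 2) * (1 + 2 * j / (1 + 2 * (z : ℂ)))) /
          (1 + exp (2 * I * (m + I * t / 2)))) =
      I * ((1 + 2 * (z : ℂ)) * (-(I * (1 / (1 + 2 * (z : ℂ)))) *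
        (exp (I * (m / (1 + 2 * (z : ℂ)) + I * (1 / (1 + 2 * (z : ℂ))) * t / 2)) /
          (1 + exp (2 * I * (m / (1 + 2 * (z : ℂ)) + I * (1 / (1 + 2 * (z : ℂ))) * t / 2))))) -
        (-1) ^ z * (-(I * 1) * (exp (I * (m + I * 1 * t / 2)) /
          (1 + exp (2 * I * (m + I * 1 * t / 2)))))) := by
    intro t ht
    rw [secKernel_sum (secDomain_add hm (le_of_lt ht)), hlin, mul_one]
    generalize exp (I * (m + I * t / 2)) / (1 + exp (2 * I * (m + I * t / 2))) = A
    generalize exp (I * ((m + I * t / 2) / (1 + 2 * (z : ℂ)))) /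
      (1 + exp (2 * I * ((m + I * t / 2) / (1 + 2 * (z : ℂ))))) = B
    field_simp
    linear_combination (B - (-1) ^ z * A) * I_sq
  have hint' := (integrableOn_congr_fun hder measurableSet_Ioi).1 (integrable_finsetSum _ hint)
  rw [hsum, setIntegral_congr_fun measurableSet_Ioi hder,
    integral_Ioi_linear_combination (logCotQ_comp_continuousWithinAt hdom')
      (logCotQ_comp_continuousWithinAt hdom) (fun t ht => logCotQ_comp_hasDerivAt hdom' ht)
      (fun t ht => logCotQ_comp_hasDerivAt hdom ht) (logCotQ_tendsto hcpos hdom')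
      (logCotQ_tendsto (by simp) hdom) hint']
  simp only [ofReal_zero, mul_zero, zero_div, add_zero]
  rw [mul_neg, ← mul_assoc, I_mul_I]
  ring

/-! ### From Euler's integral to the Lerch function -/

theorem image_exp_neg_Ioi : (fun t : ℝ => Real.exp (-t)) '' Ioi 0 = Ioo 0 1 := by
  ext u
  constructor
  · rintro ⟨t, ht, rfl⟩
    exact ⟨Real.exp_pos _, by simpa using ht⟩
  · rintro ⟨h0, h1⟩
    exact ⟨-Real.log u, by simpa using Real.log_neg h0 h1, by simp [Real.exp_log h0]⟩

/-- Substitute u = e^{-t} in Euler's integral: with c = a + 1 the factor in 1 - u has exponent 0,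
and the Gamma quotient is a. -/
theorem gaussHyp_eq_lerchPhi {a x : ℂ} (ha : 0 < a.re) :
    gaussHyp a 1 (a + 1) x = a * lerchPhi x 1 a := by
  have hG := Complex.Gamma_ne_zero_of_re_pos ha
  have h0 : a ≠ 0 := by
    rintro rfl
    simp at ha
  rw [gaussHyp, lerchPhi, Complex.Gamma_add_one a h0, add_sub_cancel_left, Complex.Gamma_one,
    mul_one, mul_div_cancel_right₀ _ hG, div_one, one_mul, ← image_exp_neg_Ioi,
    integral_image_eq_integral_abs_deriv_smul measurableSet_Ioi (f' := fun t => -Real.exp (-t))]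
  · congr 1
    refine setIntegral_congr_fun measurableSet_Ioi fun t _ => ?_
    have hpow : ((Real.exp (-t) : ℝ) : ℂ) ^ (a - 1) = exp (-(a - 1) * t) := by
      rw [cpow_def_of_ne_zero (by exact_mod_cast (Real.exp_pos _).ne'), ← ofReal_log
        (Real.exp_pos _).le, Real.log_exp]
      congr 1
      push_cast
      ring
    have hden : 1 - x * ((Real.exp (-t) : ℝ) : ℂ) = (exp t - x) / exp t := by
      rw [ofReal_exp, ofReal_neg, Complex.exp_neg, sub_div, div_self (Complex.exp_ne_zero _),
        div_eq_mul_inv]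
    simp only [sub_self, cpow_zero, one_mul, mul_one, cpow_neg_one, abs_neg, Real.abs_exp,
      real_smul]
    rw [hpow, hden, inv_div, ofReal_exp, ofReal_neg, Complex.exp_neg]
    have := Complex.exp_ne_zero t
    field_simp
  · intro t _
    have := ((hasDerivAt_neg t).exp).hasDerivWithinAt (s := Ioi 0)
    simpa using this
  · intro s _ t _ h
    simpa using h

/-! ### Exponentiation, telescoping and branches of powers -/

/-- The weight c is N^{-p} in the double product and 1 in the single one. -/
theorem prod_exp_lerchPhi {m r : ℂ} (hm : m ∈ secDomain) (hr : r ∈ secDomain) (z : ℕ) (c : ℂ) :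
    ∏ j ∈ Finset.Icc 1 z, exp (I * (-1) ^ (j + z) * c *
      (exp (I * m * (1 - 2 * (j : ℂ) / (1 + 2 * (z : ℂ)))) *
          lerchPhi (-exp (2 * I * m)) 1 (1 / 2 - (j : ℂ) / (1 + 2 * (z : ℂ)))
        + exp (I * m * (1 + 2 * (j : ℂ) / (1 + 2 * (z : ℂ)))) *
          lerchPhi (-exp (2 * I * m)) 1 (1 / 2 + (j : ℂ) / (1 + 2 * (z : ℂ)))
        - exp (I * r * (1 - 2 * (j : ℂ) / (1 + 2 * (z : ℂ)))) *
          lerchPhi (-exp (2 * I * r)) 1 (1 / 2 - (j : ℂ) / (1 + 2 * (z : ℂ)))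
        - exp (I * r * (1 + 2 * (j : ℂ) / (1 + 2 * (z : ℂ)))) *
          lerchPhi (-exp (2 * I * r)) 1 (1 / 2 + (j : ℂ) / (1 + 2 * (z : ℂ))))) =
    exp (c * ((1 + 2 * (z : ℂ)) *
      (logCotQ (m / (1 + 2 * (z : ℂ))) - logCotQ (r / (1 + 2 * (z : ℂ)))) -
        (-1) ^ z * (logCotQ m - logCotQ r))) := by
  have h : (1 + 2 * (z : ℂ)) *
      (logCotQ (m / (1 + 2 * (z : ℂ))) - logCotQ (r / (1 + 2 * (z : ℂ)))) -
        (-1) ^ z * (logCotQ m - logCotQ r) =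
      ((1 + 2 * (z : ℂ)) * logCotQ (m / (1 + 2 * (z : ℂ))) - (-1) ^ z * logCotQ m) -
      ((1 + 2 * (z : ℂ)) * logCotQ (r / (1 + 2 * (z : ℂ))) - (-1) ^ z * logCotQ r) := by ring
  rw [← Complex.exp_sum, h, ← lerchPhi_sum_eq hm, ← lerchPhi_sum_eq hr, ← mul_sub,
    ← Finset.sum_sub_distrib, Finset.mul_sum, Finset.mul_sum]
  congr 1
  refine Finset.sum_congr rfl fun j _ => ?_
  ring

theorem tanQ_div_odd (w : ℂ) (z : ℕ) : tanQ (w / (1 + 2 * (z : ℂ))) =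
    Complex.tan ((2 * w + (Real.pi : ℂ) + 2 * (Real.pi : ℂ) * z) / (4 + 8 * (z : ℂ))) := by
  have hN : (1 + 2 * (z : ℂ)) ≠ 0 := by exact_mod_cast (by omega : 1 + 2 * z ≠ 0)
  rw [tanQ, show 4 + 8 * (z : ℂ) = 4 * (1 + 2 * z) by ring]
  congr 1
  field_simp
  ring

/-- Here s = (-1)^z cancels: each summand is N^{1-p} e_p - N^{-p} d_p, and e_{p+1} = d_p makes
consecutive summands collapse. -/
theorem telescoping_sum {d e : ℕ → ℂ} {N s : ℂ} (hN : N ≠ 0) (h : ∀ p, e (p + 1) = d p) (n : ℕ) :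
    ∑ p ∈ Finset.range (n + 1), (N ^ (-(p : ℤ)) * (N * e p - s * d p) +
      -d p * (-((-1 + s) * N ^ (-(p : ℤ))))) = N * e 0 - N ^ (-(n : ℤ)) * d n := by
  induction n with
  | zero => simp; ring
  | succ n ih =>
    have hp : N ^ (-(n : ℤ)) = N ^ (-((n + 1 : ℕ) : ℤ)) * N := by
      rw [← zpow_add_one₀ hN]
      congr 1
      push_cast
      ring
    rw [Finset.sum_range_succ, ih, h, hp]
    ring

theorem exp_cpow_int (b : ℂ) (k : ℤ) : exp b ^ (k : ℂ) = exp (b * k) := by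
  rw [cpow_intCast, ← Complex.exp_int_mul, mul_comm]

theorem tanQ_div_cpow {w v : ℂ} (hw : w ∈ secDomain) (hv : v ∈ secDomain)
    (h : arg (I / tanQ v) - arg (I / tanQ w) ∈ Set.Ioc (-Real.pi) Real.pi) (c : ℂ) :
    (tanQ w / tanQ v) ^ c = exp (-(logCotQ w - logCotQ v) * c) := by
  rw [cpow_def_of_ne_zero (div_ne_zero (tanQ_ne_zero hw) (tanQ_ne_zero hv)),
    log_tanQ_div hw hv h, neg_sub]

/-- An integer power does not depend on the choice of logarithm, so no argument condition is needed.
-/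
theorem tanQ_div_cpow_int {w v : ℂ} (hw : w ∈ secDomain) (hv : v ∈ secDomain) {c : ℂ} (k : ℤ)
    (hc : c = k) : (tanQ w / tanQ v) ^ c = exp (-(logCotQ w - logCotQ v) * c) := by
  rw [← exp_logCotQ_sub hw hv, hc, exp_cpow_int, neg_sub]

/-- Both points lie in the right half-plane, so each argument is within π/2 of 0. -/
theorem arg_sub_arg_mem_of_im_pos {w v : ℂ} (hw : 0 < w.im) (hv : 0 < v.im) :
    arg (I / tanQ v) - arg (I / tanQ w) ∈ Set.Ioc (-Real.pi) Real.pi := by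
  have h1 := abs_lt.1 (Complex.abs_arg_lt_pi_div_two_iff.2 (Or.inl (re_I_div_tanQ_pos hw)))
  have h2 := abs_lt.1 (Complex.abs_arg_lt_pi_div_two_iff.2 (Or.inl (re_I_div_tanQ_pos hv)))
  constructor <;> linarith [h1.1, h1.2, h2.1, h2.2]

theorem im_mul_odd_pow_pos {w : ℂ} (hw : 0 < w.im) (z p : ℕ) :
    0 < (w * (1 + 2 * (z : ℂ)) ^ p).im := by
  rw [show (1 + 2 * (z : ℂ)) ^ p = (((1 + 2 * z) ^ p : ℝ) : ℂ) by push_cast; rfl, im_mul_ofReal]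
  positivity

/-! ### The three product formulas -/

theorem double_product_eq (z n : ℕ) (m r : ℂ)
    (hdom : ∀ p ≤ n, m * (1 + 2 * (z : ℂ)) ^ p ∈ secDomain ∧ r * (1 + 2 * (z : ℂ)) ^ p ∈ secDomain)
    (harg : ∀ p : ℕ, 1 ≤ p → p ≤ n →
      Complex.arg (Complex.I / tanQ (r * (1 + 2 * (z : ℂ)) ^ p)) -
        Complex.arg (Complex.I / tanQ (m * (1 + 2 * (z : ℂ)) ^ p)) ∈
          Set.Ioc (-Real.pi) Real.pi) :
      (∏ p ∈ Finset.range (n + 1), ∏ j ∈ Finset.Icc 1 z,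
          Complex.exp (Complex.I * (-1) ^ (j + z) * (1 + 2 * (z : ℂ)) ^ (-(p : ℤ)) *
            (Complex.exp (Complex.I * m * (1 + 2 * (z : ℂ)) ^ (-1 + (p : ℤ)) *
                  (1 - 2 * (j : ℂ) + 2 * (z : ℂ))) *
                lerchPhi (-Complex.exp (2 * Complex.I * m * (1 + 2 * (z : ℂ)) ^ p)) 1
                  (1 / 2 - (j : ℂ) / (1 + 2 * (z : ℂ)))
              + Complex.exp (Complex.I * m * (1 + 2 * (z : ℂ)) ^ (-1 + (p : ℤ)) *
                  (1 + 2 * (j : ℂ) + 2 * (z : ℂ))) *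
                lerchPhi (-Complex.exp (2 * Complex.I * m * (1 + 2 * (z : ℂ)) ^ p)) 1
                  (1 / 2 + (j : ℂ) / (1 + 2 * (z : ℂ)))
              - Complex.exp (Complex.I * r * (1 + 2 * (z : ℂ)) ^ (-1 + (p : ℤ)) *
                  (1 - 2 * (j : ℂ) + 2 * (z : ℂ))) *
                lerchPhi (-Complex.exp (2 * Complex.I * r * (1 + 2 * (z : ℂ)) ^ p)) 1
                  (1 / 2 - (j : ℂ) / (1 + 2 * (z : ℂ)))
              - Complex.exp (Complex.I * r * (1 + 2 * (z : ℂ)) ^ (-1 + (p : ℤ)) *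
                  (1 + 2 * (j : ℂ) + 2 * (z : ℂ))) *
                lerchPhi (-Complex.exp (2 * Complex.I * r * (1 + 2 * (z : ℂ)) ^ p)) 1
                  (1 / 2 + (j : ℂ) / (1 + 2 * (z : ℂ)))))) *
        (∏ p ∈ Finset.range (n + 1),
          (tanQ (m * (1 + 2 * (z : ℂ)) ^ p) / tanQ (r * (1 + 2 * (z : ℂ)) ^ p)) ^
            (-((-1 + (-1 : ℂ) ^ z) * (1 + 2 * (z : ℂ)) ^ (-(p : ℤ)))))
      = (Complex.tan ((2 * m + (Real.pi : ℂ) + 2 * (Real.pi : ℂ) * z) / (4 + 8 * (z : ℂ))) /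
            Complex.tan (((Real.pi : ℂ) + 2 * r + 2 * (Real.pi : ℂ) * z) / (4 + 8 * (z : ℂ)))) ^
            (-1 - 2 * (z : ℂ)) *
          (tanQ (m * (1 + 2 * (z : ℂ)) ^ n) / tanQ (r * (1 + 2 * (z : ℂ)) ^ n)) ^
            ((1 + 2 * (z : ℂ)) ^ (-(n : ℤ))) := by
  have hN : (1 + 2 * (z : ℂ)) ≠ 0 := by exact_mod_cast (by omega : 1 + 2 * z ≠ 0)
  have hm0 : m ∈ secDomain := by simpa using (hdom 0 (Nat.zero_le _)).1
  have hr0 : r ∈ secDomain := by simpa using (hdom 0 (Nat.zero_le _)).2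
  -- The argument condition starts at p = 1; at p = 0 the exponent must be an integer instead.
  have hcpow : ∀ p ≤ n, ∀ c : ℂ, (p = 0 → ∃ k : ℤ, c = k) →
      (tanQ (m * (1 + 2 * (z : ℂ)) ^ p) / tanQ (r * (1 + 2 * (z : ℂ)) ^ p)) ^ c =
        exp (-(logCotQ (m * (1 + 2 * (z : ℂ)) ^ p) - logCotQ (r * (1 + 2 * (z : ℂ)) ^ p)) * c) := by
    intro p hp c hc
    rcases Nat.eq_zero_or_pos p with h0 | h0
    · obtain ⟨k, hk⟩ := hc h0
      exact tanQ_div_cpow_int (hdom p hp).1 (hdom p hp).2 k hk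
    · exact tanQ_div_cpow (hdom p hp).1 (hdom p hp).2 (harg p h0 hp) c
  have hexp : ∀ (w a : ℂ) (p : ℕ), I * w * (1 + 2 * (z : ℂ)) ^ (-1 + (p : ℤ)) * a =
      I * (w * (1 + 2 * (z : ℂ)) ^ p) * (a / (1 + 2 * (z : ℂ))) := by
    intro w a p
    rw [zpow_add₀ hN, zpow_natCast, zpow_neg_one]
    ring
  have hsub : ∀ j : ℂ, (1 - 2 * j + 2 * (z : ℂ)) / (1 + 2 * (z : ℂ)) =
      1 - 2 * j / (1 + 2 * (z : ℂ)) := by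
    intro j
    field_simp
    ring
  have hadd : ∀ j : ℂ, (1 + 2 * j + 2 * (z : ℂ)) / (1 + 2 * (z : ℂ)) =
      1 + 2 * j / (1 + 2 * (z : ℂ)) := by
    intro j
    field_simp
    ring
  have hexp' : ∀ (w : ℂ) (p : ℕ), 2 * I * w * (1 + 2 * (z : ℂ)) ^ p =
    2 * I * (w * (1 + 2 * (z : ℂ)) ^ p) := fun w p => mul_assoc _ _ _
  simp only [hexp, hexp', hsub, hadd]
  rw [Finset.prod_congr rfl fun p hp => prod_exp_lerchPhi
      (hdom p (Nat.lt_succ_iff.1 (Finset.mem_range.1 hp))).1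
      (hdom p (Nat.lt_succ_iff.1 (Finset.mem_range.1 hp))).2 z _,
    Finset.prod_congr rfl fun p hp => hcpow p (Nat.lt_succ_iff.1 (Finset.mem_range.1 hp)) _ ?_,
    ← Finset.prod_mul_distrib]
  · simp only [← Complex.exp_add]
    rw [← Complex.exp_sum, telescoping_sum
        (d := fun p => logCotQ (m * (1 + 2 * (z : ℂ)) ^ p) - logCotQ (r * (1 + 2 * (z : ℂ)) ^ p))
        (e := fun p => logCotQ (m * (1 + 2 * (z : ℂ)) ^ p / (1 + 2 * (z : ℂ))) -
          logCotQ (r * (1 + 2 * (z : ℂ)) ^ p / (1 + 2 * (z : ℂ)))) hN,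
      hcpow n le_rfl _ ?_, ← tanQ_div_odd, add_comm (Real.pi : ℂ) (2 * r), ← tanQ_div_odd,
      tanQ_div_cpow_int (secDomain_div_odd hm0 z) (secDomain_div_odd hr0 z) (-1 - 2 * (z : ℤ))
        (by push_cast; rfl), ← Complex.exp_add]
    · congr 1
      simp only [pow_zero, mul_one]
      ring
    -- For n = 0 the last exponent N^{-n} is 1.
    · rintro rfl
      exact ⟨1, by simp⟩
    · intro p
      simp only [pow_succ, ← mul_assoc, mul_div_cancel_right₀ _ hN]
  -- At p = 0 the exponent is the integer 1 - (-1)^z.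
  · rintro rfl
    exact ⟨1 - (-1) ^ z, by push_cast; simp; ring⟩

theorem single_product_eq (z : ℕ) {m r : ℂ} (hm : m ∈ secDomain) (hr : r ∈ secDomain) :
    ∏ j ∈ Finset.Icc 1 z,
          Complex.exp (Complex.I * (-1) ^ (j + z) *
            (Complex.exp (Complex.I * m * (1 - 2 * (j : ℂ) / (1 + 2 * (z : ℂ)))) *
                lerchPhi (-Complex.exp (2 * Complex.I * m)) 1
                  (1 / 2 - (j : ℂ) / (1 + 2 * (z : ℂ)))
              + Complex.exp (Complex.I * m * (1 + 2 * (j : ℂ) / (1 + 2 * (z : ℂ)))) *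
                lerchPhi (-Complex.exp (2 * Complex.I * m)) 1
                  (1 / 2 + (j : ℂ) / (1 + 2 * (z : ℂ)))
              - Complex.exp (Complex.I * r * (1 - 2 * (j : ℂ) / (1 + 2 * (z : ℂ)))) *
                lerchPhi (-Complex.exp (2 * Complex.I * r)) 1
                  (1 / 2 - (j : ℂ) / (1 + 2 * (z : ℂ)))
              - Complex.exp (Complex.I * r * (1 + 2 * (j : ℂ) / (1 + 2 * (z : ℂ)))) *
                lerchPhi (-Complex.exp (2 * Complex.I * r)) 1
                  (1 / 2 + (j : ℂ) / (1 + 2 * (z : ℂ)))))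
      = tanQ m *
          (Complex.tan ((2 * m + (Real.pi : ℂ) + 2 * (Real.pi : ℂ) * z) / (4 + 8 * (z : ℂ))) /
            Complex.tan (((Real.pi : ℂ) + 2 * r + 2 * (Real.pi : ℂ) * z) / (4 + 8 * (z : ℂ)))) ^
            (-1 - 2 * (z : ℤ)) /
        (tanQ r * (tanQ m / tanQ r) ^ (1 - (-1 : ℤ) ^ z)) := by
  have h := prod_exp_lerchPhi hm hr z 1
  simp only [mul_one] at h
  rw [h, add_comm (Real.pi : ℂ) (2 * r), ← tanQ_div_odd, ← tanQ_div_odd, mul_div_mul_comm,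
    ← exp_logCotQ_sub (secDomain_div_odd hm z) (secDomain_div_odd hr z), ← exp_logCotQ_sub hm hr,
    ← Complex.exp_int_mul, ← Complex.exp_int_mul, ← Complex.exp_sub, ← Complex.exp_add]
  congr 1
  push_cast
  ring

/-- The case z = 1, N = 3: the Lerch parameters are 1/6 and 5/6, whose inverses are the coefficients
6 and 6/5, and -(-1)^z = 1 gives the plus sign. -/
theorem lerchPhi_sum_three {w : ℂ} (hw : w ∈ secDomain) :
    I * (6 * exp (I * w / 3) * gaussHyp (1 / 6) 1 (7 / 6) (-exp (2 * I * w)) +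
      6 / 5 * exp (5 * I * w / 3) * gaussHyp (5 / 6) 1 (11 / 6) (-exp (2 * I * w))) =
      3 * logCotQ (w / 3) + logCotQ w := by
  have h := lerchPhi_sum_eq hw 1
  have e1 : (1 - 2 * 1 / 3 : ℂ) = 1 / 3 := by norm_num
  have e2 : (1 + 2 * 1 / 3 : ℂ) = 5 / 3 := by norm_num
  have e3 : (1 / 2 - 1 / 3 : ℂ) = 1 / 6 := by norm_num
  have e4 : (1 / 2 + 1 / 3 : ℂ) = 5 / 6 := by norm_num
  have e5 : (1 + 2 * 1 : ℂ) = 3 := by norm_num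
  simp only [Finset.Icc_self, Finset.sum_singleton, Nat.cast_one, e1, e2, e3, e4, e5] at h
  rw [show (7 / 6 : ℂ) = 1 / 6 + 1 by norm_num, show (11 / 6 : ℂ) = 5 / 6 + 1 by norm_num,
    gaussHyp_eq_lerchPhi (by norm_num), gaussHyp_eq_lerchPhi (by norm_num),
    show I * w / 3 = I * w * (1 / 3) by ring, show 5 * I * w / 3 = I * w * (5 / 3) by ring]
  linear_combination h

theorem hypergeometric_eq {r : ℂ} (hr : r ∈ secDomain) (hr' : 1 / r ∈ secDomain) :
    Complex.exp (Complex.I *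
          (6 * Complex.exp (Complex.I / 3 / r) *
              gaussHyp (1 / 6) 1 (7 / 6) (-Complex.exp (2 * Complex.I / r))
            - 6 * Complex.exp (Complex.I * r / 3) *
              gaussHyp (1 / 6) 1 (7 / 6) (-Complex.exp (2 * Complex.I * r))
            + 6 / 5 * Complex.exp (5 * Complex.I / 3 / r) *
              gaussHyp (5 / 6) 1 (11 / 6) (-Complex.exp (2 * Complex.I / r))
            - 6 / 5 * Complex.exp (5 * Complex.I * r / 3) *
              gaussHyp (5 / 6) 1 (11 / 6) (-Complex.exp (2 * Complex.I * r))))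
      = Complex.tan (1 / 4 * (2 * r + (Real.pi : ℂ))) *
          Complex.tan (1 / 12 * (2 * r + 3 * (Real.pi : ℂ))) ^ 3 *
          Complex.cot (1 / 4 * (2 / r + (Real.pi : ℂ))) *
          Complex.cot (1 / 12 * (2 / r + 3 * (Real.pi : ℂ))) ^ 3 := by
  have h3 : ∀ {w : ℂ}, w ∈ secDomain → w / 3 ∈ secDomain := fun {w} hw => by
    have := secDomain_div_odd hw 1
    rwa [Nat.cast_one, show (1 + 2 * 1 : ℂ) = 3 by norm_num] at this
  have key : I * (6 * exp (I / 3 / r) * gaussHyp (1 / 6) 1 (7 / 6) (-exp (2 * I / r))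
      - 6 * exp (I * r / 3) * gaussHyp (1 / 6) 1 (7 / 6) (-exp (2 * I * r))
      + 6 / 5 * exp (5 * I / 3 / r) * gaussHyp (5 / 6) 1 (11 / 6) (-exp (2 * I / r))
      - 6 / 5 * exp (5 * I * r / 3) * gaussHyp (5 / 6) 1 (11 / 6) (-exp (2 * I * r))) =
      (logCotQ (1 / r) - logCotQ r) + (3 : ℕ) * (logCotQ (1 / r / 3) - logCotQ (r / 3)) := by
    have h1 := lerchPhi_sum_three hr
    have h2 := lerchPhi_sum_three hr'
    rw [show I / 3 / r = I * (1 / r) / 3 by ring, show 5 * I / 3 / r = 5 * I * (1 / r) / 3 by ring,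
      show 2 * I / r = 2 * I * (1 / r) by ring]
    push_cast
    linear_combination h2 - h1
  rw [key, Complex.exp_add, Complex.exp_nat_mul, exp_logCotQ_sub hr hr',
    exp_logCotQ_sub (h3 hr) (h3 hr'), ← Complex.tan_inv_eq_cot, ← Complex.tan_inv_eq_cot,
    show 1 / 4 * (2 * r + (Real.pi : ℂ)) = 1 / 4 * (Real.pi + 2 * r) by ring,
    show 1 / 12 * (2 * r + 3 * (Real.pi : ℂ)) = 1 / 4 * (Real.pi + 2 * (r / 3)) by ring,
    show 1 / 4 * (2 / r + (Real.pi : ℂ)) = 1 / 4 * (Real.pi + 2 * (1 / r)) by ring,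
    show 1 / 12 * (2 / r + 3 * (Real.pi : ℂ)) = 1 / 4 * (Real.pi + 2 * (1 / r / 3)) by ring]
  change tanQ r / tanQ (1 / r) * (tanQ (r / 3) / tanQ (1 / r / 3)) ^ 3 =
    tanQ r * tanQ (r / 3) ^ 3 * (tanQ (1 / r))⁻¹ * (tanQ (1 / r / 3))⁻¹ ^ 3
  ring

end

theorem mainTheorem10 :
    -- the double product, with principal values of all powers
    (∀ (z n : ℕ) (m r : ℂ), 1 ≤ z →
      ((0 < m.im ∧ 0 < r.im) ∨
        ((∀ p ≤ n,
            -Complex.exp (2 * Complex.I * m * (1 + 2 * (z : ℂ)) ^ p) ∈ cutPlane ∧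
            -Complex.exp (2 * Complex.I * r * (1 + 2 * (z : ℂ)) ^ p) ∈ cutPlane) ∧
          ∀ p : ℕ, 1 ≤ p → p ≤ n →
            Complex.arg (Complex.I / tanQ (r * (1 + 2 * (z : ℂ)) ^ p)) -
              Complex.arg (Complex.I / tanQ (m * (1 + 2 * (z : ℂ)) ^ p)) ∈
                Set.Ioc (-Real.pi) Real.pi)) →
      (∏ p ∈ Finset.range (n + 1), ∏ j ∈ Finset.Icc 1 z,
          Complex.exp (Complex.I * (-1) ^ (j + z) * (1 + 2 * (z : ℂ)) ^ (-(p : ℤ)) *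
            (Complex.exp (Complex.I * m * (1 + 2 * (z : ℂ)) ^ (-1 + (p : ℤ)) *
                  (1 - 2 * (j : ℂ) + 2 * (z : ℂ))) *
                lerchPhi (-Complex.exp (2 * Complex.I * m * (1 + 2 * (z : ℂ)) ^ p)) 1
                  (1 / 2 - (j : ℂ) / (1 + 2 * (z : ℂ)))
              + Complex.exp (Complex.I * m * (1 + 2 * (z : ℂ)) ^ (-1 + (p : ℤ)) *
                  (1 + 2 * (j : ℂ) + 2 * (z : ℂ))) *
                lerchPhi (-Complex.exp (2 * Complex.I * m * (1 + 2 * (z : ℂ)) ^ p)) 1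
                  (1 / 2 + (j : ℂ) / (1 + 2 * (z : ℂ)))
              - Complex.exp (Complex.I * r * (1 + 2 * (z : ℂ)) ^ (-1 + (p : ℤ)) *
                  (1 - 2 * (j : ℂ) + 2 * (z : ℂ))) *
                lerchPhi (-Complex.exp (2 * Complex.I * r * (1 + 2 * (z : ℂ)) ^ p)) 1
                  (1 / 2 - (j : ℂ) / (1 + 2 * (z : ℂ)))
              - Complex.exp (Complex.I * r * (1 + 2 * (z : ℂ)) ^ (-1 + (p : ℤ)) *
                  (1 + 2 * (j : ℂ) + 2 * (z : ℂ))) *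
                lerchPhi (-Complex.exp (2 * Complex.I * r * (1 + 2 * (z : ℂ)) ^ p)) 1
                  (1 / 2 + (j : ℂ) / (1 + 2 * (z : ℂ)))))) *
        (∏ p ∈ Finset.range (n + 1),
          (tanQ (m * (1 + 2 * (z : ℂ)) ^ p) / tanQ (r * (1 + 2 * (z : ℂ)) ^ p)) ^
            (-((-1 + (-1 : ℂ) ^ z) * (1 + 2 * (z : ℂ)) ^ (-(p : ℤ)))))
      = (Complex.tan ((2 * m + (Real.pi : ℂ) + 2 * (Real.pi : ℂ) * z) / (4 + 8 * (z : ℂ))) /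
            Complex.tan (((Real.pi : ℂ) + 2 * r + 2 * (Real.pi : ℂ) * z) / (4 + 8 * (z : ℂ)))) ^
            (-1 - 2 * (z : ℂ)) *
          (tanQ (m * (1 + 2 * (z : ℂ)) ^ n) / tanQ (r * (1 + 2 * (z : ℂ)) ^ n)) ^
            ((1 + 2 * (z : ℂ)) ^ (-(n : ℤ)))) ∧
    -- the single product
    (∀ (z : ℕ) (m r : ℂ), 1 ≤ z →
      -Complex.exp (2 * Complex.I * m) ∈ cutPlane →
      -Complex.exp (2 * Complex.I * r) ∈ cutPlane →
      ∏ j ∈ Finset.Icc 1 z,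
          Complex.exp (Complex.I * (-1) ^ (j + z) *
            (Complex.exp (Complex.I * m * (1 - 2 * (j : ℂ) / (1 + 2 * (z : ℂ)))) *
                lerchPhi (-Complex.exp (2 * Complex.I * m)) 1
                  (1 / 2 - (j : ℂ) / (1 + 2 * (z : ℂ)))
              + Complex.exp (Complex.I * m * (1 + 2 * (j : ℂ) / (1 + 2 * (z : ℂ)))) *
                lerchPhi (-Complex.exp (2 * Complex.I * m)) 1
                  (1 / 2 + (j : ℂ) / (1 + 2 * (z : ℂ)))
              - Complex.exp (Complex.I * r * (1 - 2 * (j : ℂ) / (1 + 2 * (z : ℂ)))) *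
                lerchPhi (-Complex.exp (2 * Complex.I * r)) 1
                  (1 / 2 - (j : ℂ) / (1 + 2 * (z : ℂ)))
              - Complex.exp (Complex.I * r * (1 + 2 * (j : ℂ) / (1 + 2 * (z : ℂ)))) *
                lerchPhi (-Complex.exp (2 * Complex.I * r)) 1
                  (1 / 2 + (j : ℂ) / (1 + 2 * (z : ℂ)))))
      = tanQ m *
          (Complex.tan ((2 * m + (Real.pi : ℂ) + 2 * (Real.pi : ℂ) * z) / (4 + 8 * (z : ℂ))) /
            Complex.tan (((Real.pi : ℂ) + 2 * r + 2 * (Real.pi : ℂ) * z) / (4 + 8 * (z : ℂ)))) ^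
            (-1 - 2 * (z : ℤ)) /
        (tanQ r * (tanQ m / tanQ r) ^ (1 - (-1 : ℤ) ^ z))) ∧
    -- the hypergeometric form
    (∀ r : ℂ, r ≠ 0 →
      -Complex.exp (2 * Complex.I * r) ∈ cutPlane →
      -Complex.exp (2 * Complex.I / r) ∈ cutPlane →
      Complex.exp (Complex.I *
          (6 * Complex.exp (Complex.I / 3 / r) *
              gaussHyp (1 / 6) 1 (7 / 6) (-Complex.exp (2 * Complex.I / r))
            - 6 * Complex.exp (Complex.I * r / 3) *
              gaussHyp (1 / 6) 1 (7 / 6) (-Complex.exp (2 * Complex.I * r))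
            + 6 / 5 * Complex.exp (5 * Complex.I / 3 / r) *
              gaussHyp (5 / 6) 1 (11 / 6) (-Complex.exp (2 * Complex.I / r))
            - 6 / 5 * Complex.exp (5 * Complex.I * r / 3) *
              gaussHyp (5 / 6) 1 (11 / 6) (-Complex.exp (2 * Complex.I * r))))
      = Complex.tan (1 / 4 * (2 * r + (Real.pi : ℂ))) *
          Complex.tan (1 / 12 * (2 * r + 3 * (Real.pi : ℂ))) ^ 3 *
          Complex.cot (1 / 4 * (2 / r + (Real.pi : ℂ))) *
          Complex.cot (1 / 12 * (2 / r + 3 * (Real.pi : ℂ))) ^ 3) := by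
  refine ⟨fun z n m r _ h => ?_, fun z m r _ hm hr => single_product_eq z hm hr,
    fun r _ hr hr' => hypergeometric_eq hr ?_⟩
  · rcases h with ⟨hm, hr⟩ | ⟨hdom, harg⟩
    · exact double_product_eq z n m r
        (fun p _ => ⟨secDomain_of_im_pos (im_mul_odd_pow_pos hm z p),
          secDomain_of_im_pos (im_mul_odd_pow_pos hr z p)⟩)
        fun p _ _ => arg_sub_arg_mem_of_im_pos (im_mul_odd_pow_pos hm z p)
          (im_mul_odd_pow_pos hr z p)
    · refine double_product_eq z n m r (fun p hp => ?_) harg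
      simpa only [secDomain, Set.mem_ofPred_eq, ← mul_assoc] using hdom p hp
  · simpa only [secDomain, Set.mem_ofPred_eq, mul_one_div] using hr'
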